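/- Let $\mathcal Y$ be a finite nonempty set and let $\phi:\mathcal Y\to\{0,1\}^d$ be a feature map. For $\theta\in\mathbb R^d$ let $p_\theta(y)=\exp\{\phi(y)^\top\theta-A(\theta)\}$ with $A(\theta)=\log\sum_{y\in\mathcal Y}\exp\{\phi(y)^\top\theta\}$. Let $\theta^*\in\mathbb R^d$ be the true parameter, and assume that the Fisher information matrix $\mathcal I=\operatorname{cov}_{y\sim p_{\theta^*}}[\phi(y)]$ is invertible. For $t>0$ put $q_t=e^{t/2}/(1+e^{t/2})$. Let $\alpha>0$, let $\delta=\sup_{y}\sup_{\tilde o}\|\tilde o\|_1$, where $\tilde o$ ranges over the support of the binarized statistics given $y$ (independent bits with $\tilde o[j]\sim\mathrm{Bernoulli}(\phi(y)[j])$, so that $\tilde o=\phi(y)$ because $\phi$ is binary), let $\bar\delta\ge\delta$ with $\bar\delta>0$, and put $q=q_{\alpha/\bar\delta}$. The per-value $\phi$-randomized response channel $S(\cdot\mid y)$ draws $\tilde o$ given $y$ and releases $o\in\{0,1\}^d$, where, independently over $j$, $o[j]=\tilde o[j]$ with probability $q$ and $o[j]=1-\tilde o[j]$ otherwise. The associated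 observation function is $\beta(o)=\dfrac{o-\mathbf 1+q\mathbf 1}{2q-1}$. Let $(y^{(i)},o^{(i)})$, $i=1,2,\dots$, be i.i.d. with $y^{(i)}\sim p_{\theta^*}$ and $o^{(i)}\sim S(\cdot\mid y^{(i)})$, let $\hat\mu_n=\frac1n\sum_{i=1}^n\beta(o^{(i)})$, and let the moments-based estimator be $$\hat\theta_n\in\arg\max_{\theta\in\mathbb R^d}\{\hat\mu_n^\top\theta-A(\theta)\},$$ a function of $o^{(1)},\dots,o^{(n)}$ (with an arbitrary value on the samples for which no maximizer exists). **Theorem (Asymptotic variance (per-value $\phi$-RR)).** The channel $S$ is $\alpha$-differentially private, i.e. $S(o\mid y)\le e^{\alpha}S(o\mid y')$ for all $o,y,y'$, and $$\sqrt n\,(\hat\theta_n-\theta^*)\ \xrightarrow{\ d\ }\ \mathcal N\bigl(0,\ \mathcal I^{-1}+\mathcal I^{-1}H\,\mathcal I^{-1}\bigr),\qquad H=\frac{q(1-q)}{(2q-1)^2}\,\mathrm{Id}_d,$$ where $\mathrm{Id}_d$ is the $d\times d$ identity matrix. -/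

import Mathlib

open MeasureTheory ProbabilityTheory Filter
open scoped ENNReal Topology

noncomputable section

namespace PerValueRR

/-! ### The exponential family -/

section Model

variable {Y : Type*} [Fintype Y] {d : ℕ}

/-- The log-partition function `A(θ) = log ∑_y exp (φ(y)ᵀ θ)`. -/
def logPartition (φ : Y → EuclideanSpace ℝ (Fin d)) (θ : EuclideanSpace ℝ (Fin d)) : ℝ :=
  Real.log (∑ y, Real.exp (inner ℝ (φ y) θ))

theorem sum_density [Nonempty Y] (φ : Y → EuclideanSpace ℝ (Fin d))
    (θ : EuclideanSpace ℝ (Fin d)) :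
    ∑ y, ENNReal.ofReal (Real.exp (inner ℝ (φ y) θ - logPartition φ θ)) = 1 := by
  have hpos : 0 < ∑ y, Real.exp (inner ℝ (φ y) θ) :=
    Finset.sum_pos (fun y _ => Real.exp_pos _) Finset.univ_nonempty
  rw [← ENNReal.ofReal_sum_of_nonneg (fun y _ => (Real.exp_pos _).le)]
  simp only [Real.exp_sub, logPartition, Real.exp_log hpos]
  rw [← Finset.sum_div, div_self hpos.ne', ENNReal.ofReal_one]

/-- The exponential family `p_θ(y) = exp (φ(y)ᵀ θ - A(θ))` on the finite set `Y`. -/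
def model [Nonempty Y] (φ : Y → EuclideanSpace ℝ (Fin d)) (θ : EuclideanSpace ℝ (Fin d)) :
    PMF Y :=
  PMF.ofFintype (fun y => ENNReal.ofReal (Real.exp (inner ℝ (φ y) θ - logPartition φ θ)))
    (sum_density φ θ)

/-- The Fisher information matrix `cov[φ(y)]`, where `y ∼ p_θ`. -/
def fisherInfo [Nonempty Y] [MeasurableSpace Y] (φ : Y → EuclideanSpace ℝ (Fin d))
    (θ : EuclideanSpace ℝ (Fin d)) : Matrix (Fin d) (Fin d) ℝ :=
  Matrix.of fun i j => cov[fun y => φ y i, fun y => φ y j; (model φ θ).toMeasure]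

end Model

/-! ### The privacy mechanism -/

/-- Bit vectors of length `d`; `true` stands for `1` and `false` for `0`. -/
abbrev Bits (d : ℕ) : Type := Fin d → Bool

/-- The real number `0` or `1` that a bit stands for. -/
def bitVal (b : Bool) : ℝ := if b then 1 else 0

theorem sum_bernoulliVec {d : ℕ} (p : Fin d → unitInterval) :
    ∑ t : Bits d, ∏ j, ENNReal.ofReal (if t j then (p j : ℝ) else 1 - (p j : ℝ)) = 1 := by
  have h := Finset.prod_univ_sum (fun _ : Fin d => (Finset.univ : Finset Bool))
    (fun j b => ENNReal.ofReal (if b then (p j : ℝ) else 1 - (p j : ℝ)))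
  rw [Fintype.piFinset_univ] at h
  rw [← h]
  refine Finset.prod_eq_one fun j _ => ?_
  have h0 := (p j).2.1
  have h1 := (p j).2.2
  simp only [Fintype.sum_bool, if_true, Bool.false_eq_true, if_false]
  rw [← ENNReal.ofReal_add h0 (by linarith)]
  simp

/-- A random bit vector with independent coordinates, the `j`-th one being `1` with
probability `p j`. -/
def bernoulliVec {d : ℕ} (p : Fin d → unitInterval) : PMF (Bits d) :=
  PMF.ofFintype (fun t => ∏ j, ENNReal.ofReal (if t j then (p j : ℝ) else 1 - (p j : ℝ)))
    (sum_bernoulliVec p)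

/-- `q_t = e^{t/2} / (1 + e^{t/2})`. -/
def q (t : ℝ) : ℝ := Real.exp (t / 2) / (1 + Real.exp (t / 2))

theorem q_mem (t : ℝ) : q t ∈ unitInterval := by
  have h := Real.exp_pos (t / 2)
  exact ⟨by unfold q; positivity, by unfold q; rw [div_le_one (by positivity)]; linarith⟩

/-- Each bit is kept with probability `q_t` and replaced by its opposite with probability
`1 - q_t`, independently over the coordinates. -/
def flipBits {d : ℕ} (t : ℝ) (b : Bits d) : PMF (Bits d) :=
  bernoulliVec fun j => if b j then ⟨q t, q_mem t⟩ else unitInterval.symm ⟨q t, q_mem t⟩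

section Mechanism

variable {Y : Type*} {d : ℕ}

/-- Binarization of the statistics: independent bits, the `j`-th one being `1` with
probability `φ(y)[j] / c`. The projection to `[0, 1]` has no effect on features with values
in `[0, c]`. -/
def binarize (c : ℝ) (φ : Y → EuclideanSpace ℝ (Fin d)) (y : Y) : PMF (Bits d) :=
  bernoulliVec fun j => Set.projIcc 0 1 zero_le_one (φ y j / c)

/-- `δ = sup ‖õ‖₁` over all `y` and all `õ` in the support of the binarization given `y`. -/
def normBound (c : ℝ) (φ : Y → EuclideanSpace ℝ (Fin d)) : ℝ :=
  sSup {r | ∃ y, ∃ t ∈ (binarize c φ y).support, r = ∑ j, |bitVal (t j)|}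

/-- The per-value `φ`-randomized response channel `S(· ∣ y)` with privacy parameter `α` and
norm bound `δ'`: binarize, then flip every bit independently with probability
`1 - q_{α/δ'}`. -/
def perValueRR (c α δ' : ℝ) (φ : Y → EuclideanSpace ℝ (Fin d)) (y : Y) : PMF (Bits d) :=
  (binarize c φ y).bind (flipBits (α / δ'))

/-- The channel `S` is `α`-differentially private: `S(o ∣ y) / S(o ∣ y') ≤ e^α` for all
`o, y, y'`. -/
def IsDifferentiallyPrivate {O : Type*} (α : ℝ) (S : Y → PMF O) : Prop :=
  ∀ (y y' : Y) (o : O), S y o ≤ ENNReal.ofReal (Real.exp α) * S y' o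

/-- The law of the pair `(y, o)`, where `y ∼ p` and `o ∼ S(· ∣ y)`. -/
def jointLaw {O : Type*} (p : PMF Y) (S : Y → PMF O) : PMF (Y × O) :=
  p.bind fun y => (S y).map fun o => (y, o)

end Mechanism

/-! ### The moments-based estimator -/

/-- The observation function of per-value `φ`-randomized response,
`β(o) = c (o - 𝟏 + q 𝟏) / (2 q - 1)` with `q = q_{α/δ'}`. -/
def obsFun {d : ℕ} (c α δ' : ℝ) (o : Bits d) : EuclideanSpace ℝ (Fin d) :=
  WithLp.toLp 2 fun j => (bitVal (o j) - 1 + q (α / δ')) / (2 * q (α / δ') - 1) * c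

/-- The estimated sufficient statistics: the empirical mean of `β(o)`. -/
def empMoment {d n : ℕ} {O : Type*} (β : O → EuclideanSpace ℝ (Fin d)) (o : Fin n → O) :
    EuclideanSpace ℝ (Fin d) :=
  (n : ℝ)⁻¹ • ∑ i, β (o i)

/-- `est`, a function of the observed samples of every size, is a moments-based estimator:
its value maximizes `θ ↦ μ̂ᵀ θ - A(θ)` over `ℝᵈ`, with `μ̂` the empirical mean of `β(o)`,
for every sample for which a maximizer exists. On the remaining samples the `arg max` is
undefined and the value of `est` is arbitrary. -/
def IsMomentEstimator {Y O : Type*} [Fintype Y] {d : ℕ} (φ : Y → EuclideanSpace ℝ (Fin d))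
    (β : O → EuclideanSpace ℝ (Fin d))
    (est : (n : ℕ) → (Fin n → O) → EuclideanSpace ℝ (Fin d)) : Prop :=
  ∀ (n : ℕ) (o : Fin n → O),
    (∃ θ, IsMaxOn (fun θ => inner ℝ (empMoment β o) θ - logPartition φ θ) Set.univ θ) →
      IsMaxOn (fun θ => inner ℝ (empMoment β o) θ - logPartition φ θ) Set.univ (est n o)

/-- `H = q (1 - q) / (2 q - 1)² • 1` with `q = q_{α/δ'}`. -/
def lossMatrix (d : ℕ) (α δ' : ℝ) : Matrix (Fin d) (Fin d) ℝ :=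
  (q (α / δ') * (1 - q (α / δ')) / (2 * q (α / δ') - 1) ^ 2) • (1 : Matrix (Fin d) (Fin d) ℝ)

end PerValueRR

end

/-!
The observation function is unbiased: given `y`, the mean of `β(o)` is `φ(y)` and its covariance
is the noise matrix `H`, whatever `y` is. By the law of total covariance `β(o)` has covariance
`I + H`, and by the central limit theorem `√n (μ̂ₙ - ∇A(θ*))` converges to `N(0, I + H)`.

A maximizer of `θ ↦ μᵀ θ - A(θ)` is a solution of `∇A(θ) = μ`, and it is unique when `I` is
invertible: for `μ = ∇A(θ)` the objective at `θ` exceeds that at `θ'` by the Kullback-Leibler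
divergence `KL(p_θ ‖ p_θ')`, which is zero only if `p_θ' = p_θ`. Hence
`θ̂ₙ = (∇A)⁻¹(μ̂ₙ)` for all large `n`, almost surely. As `(∇A)⁻¹` has derivative `I⁻¹` at
`∇A(θ*)`, the delta method gives the limit covariance `I⁻¹ (I + H) I⁻¹ = I⁻¹ + I⁻¹ H I⁻¹`.

For the privacy bound, `S(o ∣ y)` is proportional to `exp (-(t/2) dist(o, φ(y)))`, where
`t = α/δ'` and `dist` is the Hamming distance. By the triangle inequality the likelihood ratio is
at most `exp ((t/2) dist(φ(y), φ(y')))`, and two feature vectors with at most `δ'` ones each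
differ in at most `2 δ'` coordinates.
-/

namespace PerValueRR

open scoped Matrix RealInnerProductSpace

section Limits

variable {Ω : Type*} [MeasurableSpace Ω] {P : Measure Ω} [IsProbabilityMeasure P]

section CentralLimit

variable {E : Type*} [NormedAddCommGroup E] [InnerProductSpace ℝ E] [FiniteDimensional ℝ E]
  [MeasurableSpace E] [BorelSpace E] {X : ℕ → Ω → E}

theorem charFun_map_inner {Ω : Type*} [MeasurableSpace Ω] {μ : Measure Ω} {X : Ω → E}
    (hX : AEMeasurable X μ) (t : E) :
    charFun (μ.map fun ω => ⟪t, X ω⟫) 1 = charFun (μ.map X) t := by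
  rw [charFun_apply, charFun_apply, integral_map (by fun_prop) (by fun_prop),
    integral_map hX (by fun_prop)]
  simp [real_inner_comm]

theorem tendstoInDistribution_of_forall_inner {Ω' : Type*} [MeasurableSpace Ω']
    {P' : Measure Ω'} [IsProbabilityMeasure P'] {Z : Ω' → E}
    (hX : ∀ n, AEMeasurable (X n) P) (hZ : AEMeasurable Z P')
    (h : ∀ t, TendstoInDistribution (fun n ω => ⟪t, X n ω⟫) atTop (fun ω => ⟪t, Z ω⟫)
      (fun _ => P) P') :
    TendstoInDistribution X atTop Z (fun _ => P) P' := by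
  refine ⟨hX, hZ, ProbabilityMeasure.tendsto_iff_tendsto_charFun.2 fun t => ?_⟩
  have ht := ProbabilityMeasure.tendsto_iff_tendsto_charFun.1 (h t).tendsto 1
  simpa only [ProbabilityMeasure.coe_mk, charFun_map_inner (hX _), charFun_map_inner hZ] using ht

theorem hasLaw_inner_gaussianReal {ν : Measure E} [IsGaussian ν] (hν : ν[id] = 0) (t : E) :
    HasLaw (fun x => ⟪t, x⟫) (gaussianReal 0 Var[fun x => ⟪t, x⟫; ν].toNNReal) ν := by
  have hmean : ∫ x, ⟪t, x⟫ ∂ν = 0 :=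
    (integral_inner IsGaussian.integrable_id t).trans (by rw [hν, inner_zero_right])
  refine ⟨by fun_prop, ?_⟩
  simpa [hmean] using IsGaussian.map_eq_gaussianReal (μ := ν) (innerSL ℝ t)

theorem tendstoInDistribution_sqrt_smul_mean_sub {ν : Measure E} [IsGaussian ν]
    (hν : ν[id] = 0) (hX : MemLp (X 0) 2 P) (hindep : iIndepFun X P)
    (hident : ∀ i, IdentDistrib (X i) (X 0) P P)
    (hvar : ∀ t, Var[fun x => ⟪t, x⟫; ν] = Var[fun ω => ⟪t, X 0 ω⟫; P]) :
    TendstoInDistribution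
      (fun (n : ℕ) ω => √(n : ℝ) • ((n : ℝ)⁻¹ • ∑ i ∈ Finset.range n, X i ω - P[X 0]))
      atTop id (fun _ => P) ν := by
  have hXm (i : ℕ) : AEMeasurable (X i) P := (hident i).aemeasurable_fst
  refine tendstoInDistribution_of_forall_inner (fun n => by fun_prop) aemeasurable_id fun t => ?_
  have hinner : Measurable fun x : E => ⟪t, x⟫ := by fun_prop
  have hmean : ∫ ω, ⟪t, X 0 ω⟫ ∂P = ⟪t, P[X 0]⟫ := integral_inner (hX.integrable one_le_two) t
  have hclt := tendstoInDistribution_inv_sqrt_mul_sum_sub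
    (hvar t ▸ hasLaw_inner_gaussianReal hν t) (hX.const_inner t)
    (hindep.comp (fun _ x => ⟪t, x⟫) fun _ => hinner) (fun i => (hident i).comp hinner)
  refine hclt.congr (fun n => ae_of_all _ fun ω => ?_) .rfl
  rcases n.eq_zero_or_pos with rfl | hn
  · simp
  have hs : √(n : ℝ) ≠ 0 := (Real.sqrt_pos.2 (Nat.cast_pos.2 hn)).ne'
  simp only [Function.comp_apply]
  rw [hmean, real_inner_smul_right, inner_sub_right, real_inner_smul_right, inner_sum,
    ← Real.sq_sqrt n.cast_nonneg]
  field_simp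
  simp

end CentralLimit

section Delta

variable {E F : Type*}
  [NormedAddCommGroup E] [NormedSpace ℝ E] [MeasurableSpace E] [BorelSpace E]
  [SecondCountableTopology E]
  [NormedAddCommGroup F] [NormedSpace ℝ F] [MeasurableSpace F] [BorelSpace F]
  [SecondCountableTopology F]
  {Ω' : Type*} [MeasurableSpace Ω'] {P' : Measure Ω'} [IsProbabilityMeasure P']

/- Slutsky's theorem for `V = L T + ‖T‖ R + D`, with `R = ‖T‖⁻¹ (V - L T) → 0`. The remainder `D`
vanishes eventually; it is nonzero only where `T = 0` and `V ≠ 0`, since there `‖T‖⁻¹ = 0`. -/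
theorem tendstoInDistribution_of_isLittleO {T : ℕ → Ω → E} {Z : Ω' → E} {V : ℕ → Ω → F}
    {L : E →L[ℝ] F} (hT : TendstoInDistribution T atTop Z (fun _ => P) P')
    (hV : ∀ n, AEMeasurable (V n) P)
    (hVT : ∀ᵐ ω ∂P, (fun n => V n ω - L (T n ω)) =o[atTop] fun n => T n ω) :
    TendstoInDistribution V atTop (L ∘ Z) (fun _ => P) P' := by
  have hTm := hT.forall_aemeasurable
  set U : ℕ → Ω → F := fun n ω => V n ω - L (T n ω)
  have hUm (n : ℕ) : AEMeasurable (U n) P := by fun_prop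
  set R : ℕ → Ω → F := fun n ω => ‖T n ω‖⁻¹ • U n ω
  set D : ℕ → Ω → F := fun n ω => U n ω - ‖T n ω‖ • R n ω
  have hRm (n : ℕ) : AEMeasurable (R n) P := by fun_prop
  have hDm (n : ℕ) : AEMeasurable (D n) P := by fun_prop
  have hD : ∀ᵐ ω ∂P, Tendsto (fun n => D n ω) atTop (𝓝 0) := by
    filter_upwards [hVT] with ω hω
    refine tendsto_const_nhds.congr' ?_
    filter_upwards [hω.eventuallyLE] with n hn
    rcases eq_or_ne ‖T n ω‖ 0 with h0 | h0
    · rw [h0, norm_le_zero_iff] at hn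
      simp [D, U, h0, hn]
    · simp only [D, R, smul_inv_smul₀ h0, sub_self]
  have hRD : TendstoInMeasure P (fun n ω => (R n ω, D n ω)) atTop fun _ => (0, 0) := by
    refine tendstoInMeasure_of_tendsto_ae
      (fun n => ((hRm n).prodMk (hDm n)).aestronglyMeasurable) ?_
    filter_upwards [hVT, hD] with ω hω hDω
    exact hω.norm_right.tendsto_inv_smul_nhds_zero.prodMk_nhds hDω
  have hlim := hT.continuous_comp_prodMk_of_tendstoInMeasure_const
    (g := fun x : E × F × F => L x.1 + ‖x.1‖ • x.2.1 + x.2.2) (by fun_prop) hRD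
    (fun n => (hRm n).prodMk (hDm n))
  refine hlim.congr (fun n => ae_of_all _ fun ω => ?_) (ae_of_all _ fun ω => ?_)
  · simp only [D, U]
    abel
  · simp

theorem tendstoInDistribution_smul_sub_of_hasFDerivAt {X : ℕ → Ω → E} {Θ : ℕ → Ω → F}
    {Z : Ω' → E} {r : ℕ → ℝ} {h : E → F} {L : E →L[ℝ] F} {a : E} (hh : HasFDerivAt h L a)
    (hX : TendstoInDistribution (fun n ω => r n • (X n ω - a)) atTop Z (fun _ => P) P')
    (hXa : ∀ᵐ ω ∂P, Tendsto (fun n => X n ω) atTop (𝓝 a))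
    (hΘm : ∀ n, AEMeasurable (Θ n) P)
    (hΘ : ∀ᵐ ω ∂P, ∀ᶠ n in atTop, Θ n ω = h (X n ω)) :
    TendstoInDistribution (fun n ω => r n • (Θ n ω - h a)) atTop (L ∘ Z) (fun _ => P) P' := by
  refine tendstoInDistribution_of_isLittleO hX (fun n => by fun_prop) ?_
  filter_upwards [hXa, hΘ] with ω hXω hΘω
  have hsmall := (Asymptotics.isBigO_refl r atTop).smul_isLittleO
    (hh.isLittleO.comp_tendsto hXω)
  refine hsmall.congr' ?_ .rfl
  filter_upwards [hΘω] with n hn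
  simp only [Function.comp_apply, hn, map_smul, ← smul_sub]

end Delta

theorem tendstoInDistribution_id_of_hasLaw {E Ω' : Type*} [TopologicalSpace E]
    [MeasurableSpace E] [OpensMeasurableSpace E] [MeasurableSpace Ω'] {P' : Measure Ω'}
    [IsProbabilityMeasure P'] {ν : Measure E} [IsProbabilityMeasure ν] {X : ℕ → Ω → E}
    {Z : Ω' → E} (hX : TendstoInDistribution X atTop Z (fun _ => P) P') (hZ : HasLaw Z ν P') :
    TendstoInDistribution X atTop id (fun _ => P) ν where
  forall_aemeasurable := hX.forall_aemeasurable
  tendsto := by simpa only [hZ.map_eq, Measure.map_id] using hX.tendsto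

end Limits

section GaussianMap

theorem map_toEuclideanCLM_multivariateGaussian {ι : Type*} [Fintype ι] [DecidableEq ι]
    (μ : EuclideanSpace ℝ ι) {S : Matrix ι ι ℝ} (hS : S.PosSemidef) (M : Matrix ι ι ℝ) :
    (multivariateGaussian μ S).map (Matrix.toEuclideanCLM (𝕜 := ℝ) M) =
      multivariateGaussian (Matrix.toEuclideanCLM (𝕜 := ℝ) M μ) (M * S * Mᴴ) := by
  refine IsGaussian.ext ?_ ?_
  · rw [integral_map (by fun_prop) (by fun_prop), integral_id_multivariateGaussian']
    simp [ContinuousLinearMap.integral_comp_comm _ IsGaussian.integrable_fun_id]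
  · ext x y
    rw [covarianceBilin_map IsGaussian.memLp_two_id, covarianceBilin_multivariateGaussian hS,
      covarianceBilin_multivariateGaussian (hS.mul_mul_conjTranspose_same M),
      ← ContinuousLinearMap.star_eq_adjoint, ← map_star, Matrix.star_eq_conjTranspose]
    simp only [Matrix.ofLp_toEuclideanCLM, Matrix.conjTranspose_eq_transpose_of_trivial,
      Matrix.mulVec_transpose, ← Matrix.dotProduct_mulVec, Matrix.mulVec_mulVec]
    simp only [← Matrix.mulVec_transpose, Matrix.mulVec_mulVec, Matrix.mul_assoc]

end GaussianMap

section CovMatrix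

variable {Ω ι : Type*} [MeasurableSpace Ω] {μ : Measure Ω} {X : Ω → EuclideanSpace ℝ ι}

/-- The covariance matrix of a random vector: the covariances of its coordinates. -/
noncomputable def covMatrix (X : Ω → EuclideanSpace ℝ ι) (μ : Measure Ω) : Matrix ι ι ℝ :=
  Matrix.of fun i j => cov[fun ω => X ω i, fun ω => X ω j; μ]

theorem isHermitian_covMatrix : (covMatrix X μ).IsHermitian := by
  ext i j
  exact covariance_comm _ _

theorem covMatrix_comp_of_hasLaw {Ω' : Type*} [MeasurableSpace Ω'] {P : Measure Ω'} {Z : Ω' → Ω}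
    (hZ : HasLaw Z μ P) (hX : AEMeasurable X μ) : covMatrix (X ∘ Z) P = covMatrix X μ := by
  ext i j
  exact hZ.covariance_comp (f := fun ω => X ω i) (g := fun ω => X ω j) (by fun_prop) (by fun_prop)

variable [Fintype ι] [IsFiniteMeasure μ]

theorem covMatrix_mulVec_apply (hX : MemLp X 2 μ) (w : EuclideanSpace ℝ ι) (i : ι) :
    (covMatrix X μ *ᵥ w) i = cov[fun ω => X ω i, fun ω => ⟪w, X ω⟫; μ] := by
  have hcoord (j : ι) : MemLp (fun ω => X ω j) 2 μ := hX.eval_piLp j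
  simp only [PiLp.inner_apply, RCLike.inner_apply, conj_trivial]
  rw [covariance_fun_sum_right (fun j => (hcoord j).mul_const _) (hcoord i)]
  simp only [covariance_mul_const_right]
  rfl

theorem dotProduct_covMatrix_mulVec (hX : MemLp X 2 μ) (w : EuclideanSpace ℝ ι) :
    w ⬝ᵥ covMatrix X μ *ᵥ w = Var[fun ω => ⟪w, X ω⟫; μ] := by
  have hsum : (fun ω => ⟪w, X ω⟫) = fun ω => ∑ i, w i * X ω i := by
    ext ω
    simp [PiLp.inner_apply, mul_comm]
  calc w ⬝ᵥ covMatrix X μ *ᵥ w = ∑ i, cov[fun ω => w i * X ω i, fun ω => ⟪w, X ω⟫; μ] := by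
        simp only [dotProduct, covMatrix_mulVec_apply hX, covariance_const_mul_left]
    _ = cov[fun ω => ⟪w, X ω⟫, fun ω => ⟪w, X ω⟫; μ] := by
        conv_rhs => enter [1]; rw [hsum]
        exact (covariance_fun_sum_left (fun i => (hX.eval_piLp i).const_mul (w i))
          (hX.const_inner w)).symm
    _ = Var[fun ω => ⟪w, X ω⟫; μ] := covariance_self (hX.const_inner w).aemeasurable

theorem posSemidef_covMatrix (hX : MemLp X 2 μ) : (covMatrix X μ).PosSemidef := by
  refine .of_dotProduct_mulVec_nonneg isHermitian_covMatrix fun w => ?_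
  rw [star_trivial]
  exact dotProduct_covMatrix_mulVec hX (WithLp.toLp 2 w) ▸ variance_nonneg _ _

end CovMatrix

section GaussianLimit

variable {Ω : Type*} [MeasurableSpace Ω] {P : Measure Ω} [IsProbabilityMeasure P]
  {ι : Type*} [Fintype ι] [DecidableEq ι] {X : ℕ → Ω → EuclideanSpace ℝ ι}

theorem tendstoInDistribution_multivariateGaussian (hX : MemLp (X 0) 2 P)
    (hindep : iIndepFun X P) (hident : ∀ i, IdentDistrib (X i) (X 0) P P) :
    TendstoInDistribution
      (fun (n : ℕ) ω => √(n : ℝ) • ((n : ℝ)⁻¹ • ∑ i ∈ Finset.range n, X i ω - P[X 0]))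
      atTop id (fun _ => P) (multivariateGaussian 0 (covMatrix (X 0) P)) := by
  refine tendstoInDistribution_sqrt_smul_mean_sub integral_id_multivariateGaussian' hX hindep
    hident fun t => ?_
  rw [← dotProduct_covMatrix_mulVec hX, ← covarianceBilin_self IsGaussian.memLp_two_id,
    covarianceBilin_multivariateGaussian (posSemidef_covMatrix hX)]

end GaussianLimit

section LocalInverse

variable {ι : Type*} [Fintype ι] [DecidableEq ι]

theorem exists_hasFDerivAt_toEuclideanCLM_inv {f : EuclideanSpace ℝ ι → EuclideanSpace ℝ ι}
    {A : Matrix ι ι ℝ} {a : EuclideanSpace ℝ ι} (hA : IsUnit A)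
    (hf : HasStrictFDerivAt f (Matrix.toEuclideanCLM (𝕜 := ℝ) A) a) :
    ∃ g : EuclideanSpace ℝ ι → EuclideanSpace ℝ ι,
      g (f a) = a ∧ HasFDerivAt g (Matrix.toEuclideanCLM (𝕜 := ℝ) A⁻¹) (f a) ∧
      ∀ᶠ b in 𝓝 (f a), f (g b) = b := by
  obtain ⟨u, rfl⟩ := hA
  let e : EuclideanSpace ℝ ι ≃L[ℝ] EuclideanSpace ℝ ι :=
    .ofUnit (Units.map (Matrix.toEuclideanCLM (𝕜 := ℝ) (n := ι)) u)
  have he : HasStrictFDerivAt f (e : EuclideanSpace ℝ ι →L[ℝ] EuclideanSpace ℝ ι) a := hf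
  refine ⟨he.localInverse f e a, he.localInverse_apply_image, ?_, he.eventually_right_inverse⟩
  rw [← Matrix.coe_units_inv]
  exact he.to_localInverse.hasFDerivAt

end LocalInverse

section ExponentialFamily

variable {Y : Type*} [Fintype Y] {d : ℕ}

/-- The probability `p_θ(y)` as a real number. -/
noncomputable def density (φ : Y → EuclideanSpace ℝ (Fin d)) (θ : EuclideanSpace ℝ (Fin d))
    (y : Y) : ℝ :=
  Real.exp (⟪φ y, θ⟫ - logPartition φ θ)

/-- The mean parameter `E[φ(y)]`, where `y ∼ p_θ`. -/
noncomputable def meanParam (φ : Y → EuclideanSpace ℝ (Fin d)) (θ : EuclideanSpace ℝ (Fin d)) :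
    EuclideanSpace ℝ (Fin d) :=
  ∑ y, density φ θ y • φ y

/-- The function `θ ↦ μᵀ θ - A(θ)` maximized by moments-based estimation. -/
noncomputable def momentObjective (φ : Y → EuclideanSpace ℝ (Fin d))
    (μ θ : EuclideanSpace ℝ (Fin d)) : ℝ :=
  ⟪μ, θ⟫ - logPartition φ θ

variable (φ : Y → EuclideanSpace ℝ (Fin d)) (θ : EuclideanSpace ℝ (Fin d))

theorem density_pos (y : Y) : 0 < density φ θ y := Real.exp_pos _

theorem density_eq_mul_exp (θ' : EuclideanSpace ℝ (Fin d)) (y : Y) :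
    density φ θ' y =
      density φ θ y * Real.exp (⟪φ y, θ' - θ⟫ - (logPartition φ θ' - logPartition φ θ)) := by
  rw [density, density, ← Real.exp_add, inner_sub_right]
  ring_nf

theorem sum_density_mul_inner (w : EuclideanSpace ℝ (Fin d)) :
    ∑ y, density φ θ y * ⟪φ y, w⟫ = ⟪meanParam φ θ, w⟫ := by
  simp only [meanParam, sum_inner, real_inner_smul_left]

variable [Nonempty Y]

theorem toReal_model (y : Y) : (model φ θ y).toReal = density φ θ y :=
  ENNReal.toReal_ofReal (Real.exp_pos _).le

theorem sum_density_eq_one : ∑ y, density φ θ y = 1 := by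
  rw [← ENNReal.ofReal_eq_one, ENNReal.ofReal_sum_of_nonneg fun y _ => (density_pos φ θ y).le]
  exact sum_density φ θ

theorem density_eq_div (y : Y) :
    density φ θ y = Real.exp ⟪φ y, θ⟫ / ∑ y', Real.exp ⟪φ y', θ⟫ := by
  rw [density, Real.exp_sub, logPartition,
    Real.exp_log (Finset.sum_pos (fun _ _ => Real.exp_pos _) Finset.univ_nonempty)]

theorem hasStrictFDerivAt_logPartition :
    HasStrictFDerivAt (logPartition φ) (innerSL ℝ (meanParam φ θ)) θ := by
  have hpos : 0 < ∑ y, Real.exp ⟪φ y, θ⟫ :=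
    Finset.sum_pos (fun _ _ => Real.exp_pos _) Finset.univ_nonempty
  have hsum : HasStrictFDerivAt (fun θ => ∑ y, Real.exp ⟪φ y, θ⟫)
      (∑ y, Real.exp ⟪φ y, θ⟫ • innerSL ℝ (φ y)) θ :=
    .fun_sum fun y _ => (innerSL ℝ (φ y)).hasStrictFDerivAt.exp
  refine (hsum.log hpos.ne').congr_fderiv ?_
  simp only [meanParam, density_eq_div, map_sum, map_smul, Finset.smul_sum, smul_smul,
    inv_mul_eq_div]

theorem hasStrictFDerivAt_density (y : Y) :
    HasStrictFDerivAt (fun θ => density φ θ y)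
      (density φ θ y • innerSL ℝ (φ y - meanParam φ θ)) θ := by
  rw [map_sub]
  exact ((innerSL ℝ (φ y)).hasStrictFDerivAt.sub (hasStrictFDerivAt_logPartition φ θ)).exp

/-- With `x_y = log (p_θ'(y) / p_θ(y))`, the sum is `E_θ[exp x_y - x_y - 1]`. -/
theorem momentObjective_sub_momentObjective (θ' : EuclideanSpace ℝ (Fin d)) :
    momentObjective φ (meanParam φ θ) θ - momentObjective φ (meanParam φ θ) θ' =
      ∑ y, density φ θ y *
        (Real.exp (⟪φ y, θ' - θ⟫ - (logPartition φ θ' - logPartition φ θ)) -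
          (⟪φ y, θ' - θ⟫ - (logPartition φ θ' - logPartition φ θ) + 1)) := by
  simp_rw [mul_sub (density φ θ _), ← density_eq_mul_exp, mul_add, mul_sub,
    Finset.sum_sub_distrib, Finset.sum_add_distrib, Finset.sum_sub_distrib, ← Finset.sum_mul,
    sum_density_eq_one, sum_density_mul_inner, momentObjective, inner_sub_right]
  ring

theorem isMaxOn_momentObjective :
    IsMaxOn (momentObjective φ (meanParam φ θ)) Set.univ θ := by
  refine isMaxOn_iff.2 fun θ' _ => ?_
  rw [← sub_nonneg, momentObjective_sub_momentObjective]
  exact Finset.sum_nonneg fun y _ =>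
    mul_nonneg (density_pos φ θ y).le (sub_nonneg.2 (Real.add_one_le_exp _))

variable {φ θ}

theorem inner_sub_eq_of_isMaxOn {θ' : EuclideanSpace ℝ (Fin d)}
    (h : IsMaxOn (momentObjective φ (meanParam φ θ)) Set.univ θ') (y : Y) :
    ⟪φ y, θ' - θ⟫ = logPartition φ θ' - logPartition φ θ := by
  by_contra hne
  refine (isMaxOn_iff.1 h θ (Set.mem_univ θ)).not_gt ?_
  rw [← sub_pos, momentObjective_sub_momentObjective]
  exact Finset.sum_pos'
    (fun y _ => mul_nonneg (density_pos φ θ y).le (sub_nonneg.2 (Real.add_one_le_exp _)))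
    ⟨y, Finset.mem_univ y, mul_pos (density_pos φ θ y)
      (sub_pos.2 (Real.add_one_lt_exp (sub_ne_zero.2 hne)))⟩

variable [MeasurableSpace Y] [MeasurableSingletonClass Y]

/- The Fisher information at any point `θ₀` serves, because its kernel does not depend on `θ₀`: it
consists of the `w` for which `y ↦ ⟪φ y, w⟫` is constant. -/
theorem eq_of_isMaxOn_momentObjective {θ₀ θ' : EuclideanSpace ℝ (Fin d)}
    (hI : IsUnit (fisherInfo φ θ₀))
    (h : IsMaxOn (momentObjective φ (meanParam φ θ)) Set.univ θ') : θ' = θ := by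
  have hker : fisherInfo φ θ₀ *ᵥ (θ' - θ).ofLp = 0 := by
    ext i
    refine (covMatrix_mulVec_apply .of_discrete (θ' - θ) i).trans ?_
    simp_rw [real_inner_comm, inner_sub_eq_of_isMaxOn h, covariance_const_right]
    rfl
  have hzero : (θ' - θ).ofLp = 0 :=
    Matrix.mulVec_injective_of_isUnit hI (hker.trans (Matrix.mulVec_zero _).symm)
  exact sub_eq_zero.1 ((WithLp.ofLp_eq_zero 2).1 hzero)

variable (φ θ)

theorem integral_model {E : Type*} [NormedAddCommGroup E] [NormedSpace ℝ E] [CompleteSpace E]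
    (f : Y → E) : ∫ y, f y ∂(model φ θ).toMeasure = ∑ y, density φ θ y • f y := by
  simp only [PMF.integral_eq_sum, toReal_model]

theorem fisherInfo_mulVec (w : EuclideanSpace ℝ (Fin d)) :
    Matrix.toEuclideanCLM (𝕜 := ℝ) (fisherInfo φ θ) w =
      ∑ y, (density φ θ y * ⟪φ y - meanParam φ θ, w⟫) • φ y := by
  ext i
  refine (covMatrix_mulVec_apply .of_discrete w i).trans ?_
  rw [covariance_eq_sub .of_discrete .of_discrete]
  simp only [Pi.mul_apply, integral_model, smul_eq_mul, real_inner_comm _ w, sum_density_mul_inner,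
    WithLp.ofLp_sum, Finset.sum_apply, PiLp.smul_apply]
  rw [Finset.sum_mul, ← Finset.sum_sub_distrib]
  refine Finset.sum_congr rfl fun y _ => ?_
  rw [inner_sub_left]
  ring

theorem hasStrictFDerivAt_meanParam :
    HasStrictFDerivAt (meanParam φ) (Matrix.toEuclideanCLM (𝕜 := ℝ) (fisherInfo φ θ)) θ := by
  have hsum : HasStrictFDerivAt (meanParam φ)
      (∑ y, (density φ θ y • innerSL ℝ (φ y - meanParam φ θ)).smulRight (φ y)) θ :=
    .fun_sum fun y _ => (hasStrictFDerivAt_density φ θ y).smul_const (φ y)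
  refine hsum.congr_fderiv (ContinuousLinearMap.ext fun w => ?_)
  simp [fisherInfo_mulVec, inner_sub_left]

theorem isMaxOn_momentObjective_iff {θ₀ θ' : EuclideanSpace ℝ (Fin d)}
    (hI : IsUnit (fisherInfo φ θ₀)) :
    IsMaxOn (momentObjective φ (meanParam φ θ)) Set.univ θ' ↔ θ' = θ :=
  ⟨eq_of_isMaxOn_momentObjective hI, fun h => h ▸ isMaxOn_momentObjective φ θ⟩

theorem exists_isMaxOn_momentObjective_iff (hI : IsUnit (fisherInfo φ θ)) :
    ∃ g : EuclideanSpace ℝ (Fin d) → EuclideanSpace ℝ (Fin d),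
      g (meanParam φ θ) = θ ∧
      HasFDerivAt g (Matrix.toEuclideanCLM (𝕜 := ℝ) (fisherInfo φ θ)⁻¹) (meanParam φ θ) ∧
      ∀ᶠ μ in 𝓝 (meanParam φ θ), ∀ θ',
        IsMaxOn (momentObjective φ μ) Set.univ θ' ↔ θ' = g μ := by
  obtain ⟨g, hg, hderiv, hinv⟩ :=
    exists_hasFDerivAt_toEuclideanCLM_inv hI (hasStrictFDerivAt_meanParam φ θ)
  refine ⟨g, hg, hderiv, hinv.mono fun μ hμ θ' => ?_⟩
  rw [← isMaxOn_momentObjective_iff φ (g μ) hI, hμ]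

end ExponentialFamily

section MomentEstimator

variable {Ω O : Type*} {d : ℕ} {β : O → EuclideanSpace ℝ (Fin d)} {W : ℕ → Ω → O}

theorem empMoment_eq_sum_range (n : ℕ) (ω : Ω) :
    empMoment β (fun i : Fin n => W i ω) = (n : ℝ)⁻¹ • ∑ i ∈ Finset.range n, β (W i ω) := by
  rw [empMoment, Fin.sum_univ_eq_sum_range fun i => β (W i ω)]

variable [MeasurableSpace Ω] {P : Measure Ω} [MeasurableSpace O] {ν : Measure O}

theorem tendsto_empMoment (hβ : Measurable β) (hint : Integrable β ν) (hindep : iIndepFun W P)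
    (hlaw : ∀ i, HasLaw (W i) ν P) :
    ∀ᵐ ω ∂P, Tendsto (fun n => empMoment β fun i : Fin n => W i ω) atTop (𝓝 (ν[β])) := by
  simp_rw [empMoment_eq_sum_range, ← (hlaw 0).integral_comp hβ.aestronglyMeasurable]
  exact strong_law_ae (fun i => β ∘ W i)
    ((hlaw 0).map_eq ▸ hint |>.comp_aemeasurable (hlaw 0).aemeasurable)
    (fun i j hij => (hindep.indepFun hij).comp hβ hβ)
    fun i => ((hlaw i).identDistrib (hlaw 0)).comp hβ

variable [IsProbabilityMeasure P]

theorem tendstoInDistribution_empMoment (hβ : Measurable β) (hmem : MemLp β 2 ν)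
    (hindep : iIndepFun W P) (hlaw : ∀ i, HasLaw (W i) ν P) :
    TendstoInDistribution
      (fun (n : ℕ) ω => √(n : ℝ) • (empMoment β (fun i : Fin n => W i ω) - ν[β]))
      atTop id (fun _ => P) (multivariateGaussian 0 (covMatrix β ν)) := by
  simp_rw [empMoment_eq_sum_range, ← (hlaw 0).integral_comp hβ.aestronglyMeasurable,
    ← covMatrix_comp_of_hasLaw (hlaw 0) hβ.aemeasurable]
  exact tendstoInDistribution_multivariateGaussian
    ((hlaw 0).map_eq ▸ hmem |>.comp_of_map (hlaw 0).aemeasurable)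
    (hindep.comp (fun _ => β) fun _ => hβ) fun i => ((hlaw i).identDistrib (hlaw 0)).comp hβ

variable {Y : Type*} [Fintype Y] [Nonempty Y] [MeasurableSpace Y] [MeasurableSingletonClass Y]
  {φ : Y → EuclideanSpace ℝ (Fin d)} {θ : EuclideanSpace ℝ (Fin d)}
  {est : (n : ℕ) → (Fin n → O) → EuclideanSpace ℝ (Fin d)}

theorem tendstoInDistribution_momentEstimator (hI : IsUnit (fisherInfo φ θ)) (hβ : Measurable β)
    (hmem : MemLp β 2 ν) (hmean : ν[β] = meanParam φ θ) (hindep : iIndepFun W P)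
    (hlaw : ∀ i, HasLaw (W i) ν P) (hestm : ∀ n, Measurable (est n))
    (hest : IsMomentEstimator φ β est) :
    TendstoInDistribution (fun (n : ℕ) ω => √(n : ℝ) • (est n (fun i : Fin n => W i ω) - θ))
      atTop id (fun _ => P)
      (multivariateGaussian 0 ((fisherInfo φ θ)⁻¹ * covMatrix β ν * (fisherInfo φ θ)⁻¹)) := by
  have : IsProbabilityMeasure ν := (hlaw 0).isProbabilityMeasure_iff.1 ‹_›
  obtain ⟨g, hg, hderiv, hmax⟩ := exists_isMaxOn_momentObjective_iff φ θ hI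
  have hlln := tendsto_empMoment hβ (hmem.integrable one_le_two) hindep hlaw
  have hclt := tendstoInDistribution_empMoment hβ hmem hindep hlaw
  rw [hmean] at hlln hclt
  have hest_eq : ∀ᵐ ω ∂P, ∀ᶠ n in atTop,
      est n (fun i : Fin n => W i ω) = g (empMoment β fun i : Fin n => W i ω) := by
    filter_upwards [hlln] with ω hω
    filter_upwards [hω.eventually hmax] with n hn
    exact (hn _).1 (hest n _ ⟨_, (hn _).2 rfl⟩)
  have hestW (n : ℕ) : AEMeasurable (fun ω => est n fun i : Fin n => W i ω) P :=
    (hestm n).comp_aemeasurable (aemeasurable_pi_lambda _ fun i => (hlaw i).aemeasurable)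
  have hdelta := tendstoInDistribution_smul_sub_of_hasFDerivAt hderiv hclt hlln hestW hest_eq
  rw [hg] at hdelta
  refine tendstoInDistribution_id_of_hasLaw hdelta ⟨by fun_prop, ?_⟩
  have hherm : ((fisherInfo φ θ)⁻¹).IsHermitian := isHermitian_covMatrix.inv
  rw [Function.comp_id, map_toEuclideanCLM_multivariateGaussian 0 (posSemidef_covMatrix hmem),
    hherm.eq, map_zero]

end MomentEstimator

section Mixture

variable {Y O : Type*} (p : PMF Y) (S : Y → PMF O)

theorem map_snd_jointLaw : (jointLaw p S).map Prod.snd = p.bind S := by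
  simp only [jointLaw, PMF.map_bind, PMF.map_comp]
  exact congrArg p.bind (funext fun y => PMF.map_id (S y))

variable [Finite Y] [Finite O] [MeasurableSpace Y] [MeasurableSingletonClass Y]
  [MeasurableSpace O] [MeasurableSingletonClass O]

theorem integral_bind {E : Type*} [NormedAddCommGroup E] [NormedSpace ℝ E] [CompleteSpace E]
    (f : O → E) :
    ∫ o, f o ∂(p.bind S).toMeasure = ∫ y, ∫ o, f o ∂(S y).toMeasure ∂p.toMeasure := by
  have := Fintype.ofFinite Y
  have := Fintype.ofFinite O
  simp only [PMF.integral_eq_sum, PMF.bind_apply, tsum_fintype, Finset.smul_sum]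
  rw [Finset.sum_comm]
  refine Finset.sum_congr rfl fun o _ => ?_
  rw [ENNReal.toReal_sum fun y _ => ENNReal.mul_ne_top (p.apply_ne_top y) ((S y).apply_ne_top o),
    Finset.sum_smul]
  simp only [ENNReal.toReal_mul, mul_smul]

theorem covariance_bind (f g : O → ℝ) :
    cov[f, g; (p.bind S).toMeasure] =
      cov[fun y => (S y).toMeasure[f], fun y => (S y).toMeasure[g]; p.toMeasure] +
        ∫ y, cov[f, g; (S y).toMeasure] ∂p.toMeasure := by
  simp only [covariance_eq_sub MemLp.of_discrete MemLp.of_discrete]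
  rw [integral_sub .of_finite .of_finite]
  simp only [Pi.mul_apply, integral_bind]
  ring

theorem covMatrix_bind {ι : Type*} [Fintype ι] {β : O → EuclideanSpace ℝ ι}
    {m : Y → EuclideanSpace ℝ ι} {H : Matrix ι ι ℝ} (hmean : ∀ y, (S y).toMeasure[β] = m y)
    (hcov : ∀ y, covMatrix β (S y).toMeasure = H) :
    covMatrix β (p.bind S).toMeasure = covMatrix m p.toMeasure + H := by
  have hcoord (y : Y) (i : ι) : ∫ o, β o i ∂(S y).toMeasure = m y i := by
    rw [← hmean, eval_integral_piLp fun _ => .of_finite]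
  have hentry (i j : ι) (y : Y) :
      cov[fun o => β o i, fun o => β o j; (S y).toMeasure] = H i j := by
    rw [← hcov y]
    rfl
  ext i j
  refine (covariance_bind p S (fun o => β o i) fun o => β o j).trans ?_
  simp only [hcoord, hentry, integral_const, probReal_univ, one_smul]
  rfl

end Mixture

section Channel

variable {d : ℕ}

theorem toMeasure_bernoulliVec (p : Fin d → unitInterval) :
    (bernoulliVec p).toMeasure = Measure.pi fun j => bernoulliMeasure true false (p j) := by
  refine Measure.ext_of_singleton fun t => ?_
  rw [PMF.toMeasure_apply_singleton _ _ (measurableSet_singleton t), Measure.pi_singleton,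
    bernoulliVec, PMF.ofFintype_apply]
  refine Finset.prod_congr rfl fun j _ => ?_
  cases t j <;> simp [← ENNReal.ofReal_coe_nnreal]

theorem integral_bitVal_bernoulliVec (p : Fin d → unitInterval) (i : Fin d) :
    ∫ t, bitVal (t i) ∂(bernoulliVec p).toMeasure = p i := by
  rw [toMeasure_bernoulliVec]
  refine (integral_comp_eval (μ := fun j => bernoulliMeasure true false (p j))
    (.of_discrete (f := bitVal))).trans ?_
  simp [integral_bernoulliMeasure, bitVal]

theorem covariance_bitVal_bernoulliVec (p : Fin d → unitInterval) (i j : Fin d) :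
    cov[fun t => bitVal (t i), fun t => bitVal (t j); (bernoulliVec p).toMeasure] =
      if i = j then (p i : ℝ) * (1 - p i) else 0 := by
  split_ifs with hij
  · subst hij
    have hsq (t : Bits d) : bitVal (t i) * bitVal (t i) = bitVal (t i) := by
      cases t i <;> simp [bitVal]
    rw [covariance_eq_sub .of_discrete .of_discrete]
    simp only [Pi.mul_apply, hsq, integral_bitVal_bernoulliVec]
    ring
  · rw [toMeasure_bernoulliVec]
    have hindep := iIndepFun_pi (μ := fun j => bernoulliMeasure true false (p j))
      fun _ => (measurable_of_finite bitVal).aemeasurable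
    exact (hindep.indepFun hij).covariance_eq_zero .of_discrete .of_discrete

theorem two_mul_q_sub_one_ne_zero {t : ℝ} (ht : 0 < t) : 2 * q t - 1 ≠ 0 := by
  have hexp : 1 < Real.exp (t / 2) := Real.one_lt_exp_iff.2 (half_pos ht)
  rw [q, mul_div_assoc', div_sub_one (by positivity)]
  exact div_ne_zero (by linarith) (by positivity)

theorem integral_bitVal_flipBits (t : ℝ) (b : Bits d) (j : Fin d) :
    ∫ o, bitVal (o j) ∂(flipBits t b).toMeasure = (2 * q t - 1) * bitVal (b j) + (1 - q t) := by
  rw [flipBits, integral_bitVal_bernoulliVec]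
  cases b j <;> simp [bitVal]
  ring

theorem covariance_bitVal_flipBits (t : ℝ) (b : Bits d) (i j : Fin d) :
    cov[fun o => bitVal (o i), fun o => bitVal (o j); (flipBits t b).toMeasure] =
      if i = j then q t * (1 - q t) else 0 := by
  rw [flipBits, covariance_bitVal_bernoulliVec]
  cases b i <;> simp [mul_comm]

theorem obsFun_apply (α δ' : ℝ) (o : Bits d) (j : Fin d) :
    obsFun 1 α δ' o j = (bitVal (o j) - (1 - q (α / δ'))) / (2 * q (α / δ') - 1) := by
  simp [obsFun, sub_add]

theorem integral_obsFun_flipBits {α δ' : ℝ} (ht : 0 < α / δ') (b : Bits d) :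
    ∫ o, obsFun 1 α δ' o ∂(flipBits (α / δ') b).toMeasure =
      WithLp.toLp 2 fun j => bitVal (b j) := by
  ext j
  rw [eval_integral_piLp fun _ => .of_finite]
  simp_rw [obsFun_apply]
  rw [integral_div, integral_sub .of_finite .of_finite, integral_bitVal_flipBits, integral_const,
    probReal_univ, one_smul, add_sub_cancel_right,
    mul_div_cancel_left₀ _ (two_mul_q_sub_one_ne_zero ht)]

theorem covMatrix_obsFun_flipBits (α δ' : ℝ) (b : Bits d) :
    covMatrix (obsFun 1 α δ') (flipBits (α / δ') b).toMeasure = lossMatrix d α δ' := by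
  ext i j
  simp only [covMatrix, Matrix.of_apply, obsFun_apply, div_eq_mul_inv, covariance_mul_const_left,
    covariance_mul_const_right]
  rw [covariance_sub_const_left .of_finite, covariance_sub_const_right .of_finite,
    covariance_bitVal_flipBits, lossMatrix, Matrix.smul_apply, Matrix.one_apply]
  split_ifs <;> simp [div_eq_mul_inv, mul_assoc, sq]

end Channel

section BinaryFeatures

variable {Y : Type*} {d : ℕ} {φ : Y → EuclideanSpace ℝ (Fin d)}

/-- The feature vector `φ(y)` as a bit vector: a coordinate is `true` when it is positive. -/
noncomputable def featureBits (φ : Y → EuclideanSpace ℝ (Fin d)) (y : Y) : Bits d :=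
  fun j => decide (0 < φ y j)

theorem toLp_bitVal_featureBits (hφ : ∀ y j, φ y j = 0 ∨ φ y j = 1) (y : Y) :
    WithLp.toLp 2 (fun j => bitVal (featureBits φ y j)) = φ y := by
  ext j
  rcases hφ y j with h | h <;> simp [bitVal, featureBits, h]

theorem bernoulliVec_ite_one_zero (b : Bits d) :
    bernoulliVec (fun j => if b j then 1 else 0) = PMF.pure b := by
  ext o
  have hfactor (j : Fin d) :
      ENNReal.ofReal (if o j then ((if b j then 1 else 0 : unitInterval) : ℝ)
        else 1 - (if b j then 1 else 0 : unitInterval)) = if o j = b j then 1 else 0 := by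
    cases o j <;> cases b j <;> simp
  simp only [bernoulliVec, PMF.ofFintype_apply, PMF.pure_apply, hfactor, Finset.prod_ite_zero]
  simp [funext_iff]

theorem binarize_eq_pure (hφ : ∀ y j, φ y j = 0 ∨ φ y j = 1) (y : Y) :
    binarize 1 φ y = PMF.pure (featureBits φ y) := by
  rw [binarize, ← bernoulliVec_ite_one_zero]
  congr 1
  ext j
  rcases hφ y j with h | h <;> simp [featureBits, h]

theorem perValueRR_eq_flipBits (hφ : ∀ y j, φ y j = 0 ∨ φ y j = 1) (α δ' : ℝ) (y : Y) :
    perValueRR 1 α δ' φ y = flipBits (α / δ') (featureBits φ y) := by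
  rw [perValueRR, binarize_eq_pure hφ, PMF.pure_bind]

end BinaryFeatures

section Privacy

variable {d : ℕ}

theorem one_sub_q (t : ℝ) : 1 - q t = q t * Real.exp (-(t / 2)) := by
  have hpos : 0 < 1 + Real.exp (t / 2) := by positivity
  rw [q, one_sub_div hpos.ne', add_sub_cancel_right, div_mul_eq_mul_div, ← Real.exp_add,
    add_neg_cancel, Real.exp_zero]

theorem flipBits_apply_eq_prod (t : ℝ) (b o : Bits d) :
    flipBits t b o = ∏ j, ENNReal.ofReal (if o j = b j then q t else 1 - q t) := by
  rw [flipBits, bernoulliVec, PMF.ofFintype_apply]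
  refine Finset.prod_congr rfl fun j _ => ?_
  cases o j <;> cases b j <;> simp

theorem flipBits_apply (t : ℝ) (b o : Bits d) :
    flipBits t b o =
      ENNReal.ofReal (q t ^ d * Real.exp (-(t / 2) * (hammingDist o b : ℝ))) := by
  have hfactor (j : Fin d) : (if o j = b j then q t else 1 - q t) =
      q t * Real.exp (-(t / 2) * if o j ≠ b j then 1 else 0) := by
    by_cases h : o j = b j <;> simp [h, one_sub_q]
  simp only [flipBits_apply_eq_prod, hfactor]
  rw [← ENNReal.ofReal_prod_of_nonneg fun j _ => mul_nonneg (q_mem t).1 (Real.exp_pos _).le,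
    Finset.prod_mul_distrib, Finset.prod_const, Finset.card_fin, ← Real.exp_sum, ← Finset.mul_sum,
    hammingDist, Finset.natCast_card_filter]

theorem flipBits_le_exp_hammingDist_mul {t : ℝ} (ht : 0 ≤ t) (b b' o : Bits d) :
    flipBits t b o ≤
      ENNReal.ofReal (Real.exp (t / 2 * (hammingDist b b' : ℝ))) * flipBits t b' o := by
  have htriangle : (hammingDist o b' : ℝ) ≤ hammingDist o b + hammingDist b b' := by
    exact_mod_cast hammingDist_triangle o b b'
  rw [flipBits_apply, flipBits_apply, ← ENNReal.ofReal_mul (Real.exp_pos _).le, mul_left_comm,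
    ← Real.exp_add]
  refine ENNReal.ofReal_le_ofReal (mul_le_mul_of_nonneg_left (Real.exp_le_exp.2 ?_)
    (pow_nonneg (q_mem t).1 d))
  linarith [mul_le_mul_of_nonneg_left htriangle (div_nonneg ht zero_le_two)]

theorem hammingDist_le_sum_bitVal (b b' : Bits d) :
    (hammingDist b b' : ℝ) ≤ ∑ j, bitVal (b j) + ∑ j, bitVal (b' j) := by
  rw [hammingDist, Finset.natCast_card_filter, ← Finset.sum_add_distrib]
  refine Finset.sum_le_sum fun j _ => ?_
  cases b j <;> cases b' j <;> simp [bitVal]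

variable {Y : Type*} {φ : Y → EuclideanSpace ℝ (Fin d)}

theorem bddAbove_norm_binarize (c : ℝ) (φ : Y → EuclideanSpace ℝ (Fin d)) :
    BddAbove {r | ∃ y, ∃ t ∈ (binarize c φ y).support, r = ∑ j, |bitVal (t j)|} := by
  refine ((Set.finite_range fun t : Bits d => ∑ j, |bitVal (t j)|).subset ?_).bddAbove
  rintro _ ⟨_, t, _, rfl⟩
  exact ⟨t, rfl⟩

theorem sum_bitVal_featureBits_le_normBound (hφ : ∀ y j, φ y j = 0 ∨ φ y j = 1) (y : Y) :
    ∑ j, bitVal (featureBits φ y j) ≤ normBound 1 φ := by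
  refine le_csSup (bddAbove_norm_binarize 1 φ) ⟨y, featureBits φ y, ?_, ?_⟩
  · simp [binarize_eq_pure hφ]
  · exact Finset.sum_congr rfl fun j _ => by cases featureBits φ y j <;> simp [bitVal]

theorem isDifferentiallyPrivate_perValueRR (hφ : ∀ y j, φ y j = 0 ∨ φ y j = 1) {α δ' : ℝ}
    (hα : 0 ≤ α) (hδ' : 0 < δ') (hδ : normBound 1 φ ≤ δ') :
    IsDifferentiallyPrivate α (perValueRR 1 α δ' φ) := by
  intro y y' o
  have ht : 0 ≤ α / δ' := div_nonneg hα hδ'.le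
  have hdist : (hammingDist (featureBits φ y) (featureBits φ y') : ℝ) ≤ 2 * δ' := by
    linarith [hammingDist_le_sum_bitVal (featureBits φ y) (featureBits φ y'),
      sum_bitVal_featureBits_le_normBound hφ y, sum_bitVal_featureBits_le_normBound hφ y']
  have hexponent : α / δ' / 2 * (2 * δ') = α := by field_simp
  simp only [perValueRR_eq_flipBits hφ]
  refine (flipBits_le_exp_hammingDist_mul ht _ (featureBits φ y') o).trans ?_
  gcongr
  exact (mul_le_mul_of_nonneg_left hdist (by positivity)).trans_eq hexponent

end Privacy

section Observation

variable {Y : Type*} [Fintype Y] [Nonempty Y] [MeasurableSpace Y] [MeasurableSingletonClass Y]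
  {d : ℕ} {φ : Y → EuclideanSpace ℝ (Fin d)}

theorem integral_obsFun (hφ : ∀ y j, φ y j = 0 ∨ φ y j = 1) (θ : EuclideanSpace ℝ (Fin d))
    {α δ' : ℝ} (ht : 0 < α / δ') :
    ∫ o, obsFun 1 α δ' o ∂((model φ θ).bind (perValueRR 1 α δ' φ)).toMeasure =
      meanParam φ θ := by
  simp only [integral_bind, perValueRR_eq_flipBits hφ, integral_obsFun_flipBits ht,
    toLp_bitVal_featureBits hφ, integral_model, meanParam]

theorem covMatrix_obsFun (hφ : ∀ y j, φ y j = 0 ∨ φ y j = 1) (θ : EuclideanSpace ℝ (Fin d))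
    {α δ' : ℝ} (ht : 0 < α / δ') :
    covMatrix (obsFun 1 α δ') ((model φ θ).bind (perValueRR 1 α δ' φ)).toMeasure =
      fisherInfo φ θ + lossMatrix d α δ' := by
  refine covMatrix_bind _ _ (m := φ) (fun y => ?_) fun y => ?_
  · rw [perValueRR_eq_flipBits hφ, integral_obsFun_flipBits ht, toLp_bitVal_featureBits hφ]
  · rw [perValueRR_eq_flipBits hφ, covMatrix_obsFun_flipBits]

end Observation

end PerValueRR

theorem mainTheorem5 {Y : Type*} [Fintype Y] [Nonempty Y] [MeasurableSpace Y]
    [MeasurableSingletonClass Y] {d : ℕ}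
    -- binary features, true parameter, nonsingular Fisher information
    (φ : Y → EuclideanSpace ℝ (Fin d)) (hφ : ∀ y j, φ y j = 0 ∨ φ y j = 1)
    (θstar : EuclideanSpace ℝ (Fin d)) (hI : IsUnit (PerValueRR.fisherInfo φ θstar))
    -- privacy level and upper bound on the norm of the binarized statistics
    (α δ' : ℝ) (hα : 0 < α) (hδ' : 0 < δ') (hδ : PerValueRR.normBound 1 φ ≤ δ')
    -- i.i.d. pairs of a label drawn from the model and its privatized observation
    {Ω : Type*} [MeasurableSpace Ω] (P : Measure Ω) [IsProbabilityMeasure P]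
    (Z : ℕ → Ω → Y × PerValueRR.Bits d)
    (hZ_indep : iIndepFun Z P)
    (hZ_law : ∀ i, HasLaw (Z i)
      (PerValueRR.jointLaw (PerValueRR.model φ θstar)
        (PerValueRR.perValueRR 1 α δ' φ)).toMeasure P)
    -- the moments-based estimator, a function of the observations alone
    (est : (n : ℕ) → (Fin n → PerValueRR.Bits d) → EuclideanSpace ℝ (Fin d))
    (hest : PerValueRR.IsMomentEstimator φ (PerValueRR.obsFun 1 α δ') est) :
    PerValueRR.IsDifferentiallyPrivate α (PerValueRR.perValueRR 1 α δ' φ) ∧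
    TendstoInDistribution
      (fun (n : ℕ) ω => √(n : ℝ) • (est n (fun i : Fin n => (Z i ω).2) - θstar))
      atTop id (fun _ => P)
      (multivariateGaussian 0
        ((PerValueRR.fisherInfo φ θstar)⁻¹ +
          (PerValueRR.fisherInfo φ θstar)⁻¹ * PerValueRR.lossMatrix d α δ' *
            (PerValueRR.fisherInfo φ θstar)⁻¹)) := by
  have ht : 0 < α / δ' := div_pos hα hδ'
  have hobs_law (i : ℕ) : HasLaw (fun ω => (Z i ω).2)
      ((PerValueRR.model φ θstar).bind (PerValueRR.perValueRR 1 α δ' φ)).toMeasure P := by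
    rw [← PerValueRR.map_snd_jointLaw, ← PMF.toMeasure_map _ _ measurable_snd]
    exact HasLaw.comp ⟨by fun_prop, rfl⟩ (hZ_law i)
  have hclt := PerValueRR.tendstoInDistribution_momentEstimator hI (measurable_of_finite _)
    .of_discrete (PerValueRR.integral_obsFun hφ θstar ht)
    (hZ_indep.comp (fun _ => Prod.snd) fun _ => measurable_snd) hobs_law
    (fun n => measurable_of_finite _) hest
  rw [PerValueRR.covMatrix_obsFun hφ θstar ht, mul_add, add_mul,
    Matrix.nonsing_inv_mul _ ((Matrix.isUnit_iff_isUnit_det _).1 hI), one_mul] at hclt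
  exact ⟨PerValueRR.isDifferentiallyPrivate_perValueRR hφ hα.le hδ' hδ, hclt⟩
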